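/- A networked system $\Sigma$ consists of $N$ linear time-invariant subsystems with real matrices, $$x(t+1,i)=A_{TT}(i)x(t,i)+A_{TS}(i)v(t,i)+B_T(i)u(t,i),$$ $$z(t,i)=A_{ST}(i)x(t,i)+A_{SS}(i)v(t,i)+B_S(i)u(t,i),$$ $$y(t,i)=C_T(i)x(t,i)+C_S(i)v(t,i)+D(i)u(t,i),$$ for $i=1,\dots,N$ and $t=0,1,2,\dots$, where $x(t,i)$ is the state, $u(t,i)$ and $y(t,i)$ are the local external input and output, and $v(t,i)$ and $z(t,i)$ are the internal input and output of subsystem $i$. With $v(t)$ and $z(t)$ the vectors stacking all $v(t,i)$ and all $z(t,i)$, the subsystems are interconnected by $v(t)=\Phi z(t)$, where every row of the constant matrix $\Phi$ has exactly one nonzero element, which equals one (an internal output may also be fed back to its own subsystem). The system is assumed to be well-posed, that is, $I-\Phi\,\mathrm{diag}\{A_{SS}(1),\dots,A_{SS}(N)\}$ is invertible. $\Sigma$ is observable if the external inputs and external outputs at all times $t\ge 0$ determine the initial state of the whole system, and controllable if every initial state of the whole system can be steered to every final state in finite time by the external inputs. Write $m_{\star i}$ for the dimension of $\star(t,i)$,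 $\star=u,v,y,z$. Let the real state transition matrices $A_{TT}(1),\dots,A_{TT}(N)$ be prescribed, and let $p_{\max}(i)$ be the maximum geometric multiplicity of $A_{TT}(i)$, i.e. $p_{\max}(i)=\max_{\lambda\in\mathbb C}\dim_{\mathbb C}\ker(\lambda I-A_{TT}(i))$. (a) Let the dimensions $m_{yi},m_{zi}\ge 0$ be given, with $m_{yi}\ge 1$ for at least one $i$. The remaining dimensions $m_{ui},m_{vi}$, the remaining subsystem matrices and $\Phi$ can be chosen so that $\Sigma$ is a well-posed, observable networked system if and only if $m_{yi}+m_{zi}\ge p_{\max}(i)$ for every $i=1,\dots,N$. (b) Let the dimensions $m_{ui},m_{vi}\ge 0$ be given, with $m_{ui}\ge 1$ for at least one $i$. The remaining dimensions $m_{yi},m_{zi}$, the remaining subsystem matrices and $\Phi$ can be chosen so that $\Sigma$ is a well-posed, controllable networked system if and only if $m_{ui}+m_{vi}\ge p_{\max}(i)$ for every $i=1,\dots,N$. -/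

import Mathlib

open scoped Matrix

/-- The maximum geometric multiplicity of a real square matrix: the largest dimension, over all
complex numbers `μ`, of the complex eigenspace `{w | A w = μ w}`. -/
noncomputable def maxGeomMult {n : ℕ} (A : Matrix (Fin n) (Fin n) ℝ) : ℕ :=
  ⨆ μ : ℂ, Module.finrank ℂ
    (Module.End.eigenspace (Matrix.toLin' (A.map (algebraMap ℝ ℂ))) μ)

/-- The supremum in `maxGeomMult` is a supremum of a bounded set of natural numbers. -/
theorem maxGeomMult_bddAbove {n : ℕ} (A : Matrix (Fin n) (Fin n) ℝ) :
    BddAbove (Set.range fun μ : ℂ => Module.finrank ℂ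
      (Module.End.eigenspace (Matrix.toLin' (A.map (algebraMap ℝ ℂ))) μ)) := by
  refine ⟨n, ?_⟩
  rintro _ ⟨μ, rfl⟩
  simpa using Submodule.finrank_le
    (Module.End.eigenspace (Matrix.toLin' (A.map (algebraMap ℝ ℂ))) μ)

/-- The data of a networked system with `N` linear time invariant subsystems.  Subsystem `i` has
state dimension `nx i`, external input dimension `nu i`, internal input dimension `nv i`, external
output dimension `ny i` and internal output dimension `nz i`; `Phi` is the subsystem connection
matrix, acting on the stacked internal outputs. -/
structure NetworkedSystem {N : ℕ} (nx nu nv ny nz : Fin N → ℕ) where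
  ATT : ∀ i, Matrix (Fin (nx i)) (Fin (nx i)) ℝ
  ATS : ∀ i, Matrix (Fin (nx i)) (Fin (nv i)) ℝ
  BT : ∀ i, Matrix (Fin (nx i)) (Fin (nu i)) ℝ
  AST : ∀ i, Matrix (Fin (nz i)) (Fin (nx i)) ℝ
  ASS : ∀ i, Matrix (Fin (nz i)) (Fin (nv i)) ℝ
  BS : ∀ i, Matrix (Fin (nz i)) (Fin (nu i)) ℝ
  CT : ∀ i, Matrix (Fin (ny i)) (Fin (nx i)) ℝ
  CS : ∀ i, Matrix (Fin (ny i)) (Fin (nv i)) ℝ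
  D : ∀ i, Matrix (Fin (ny i)) (Fin (nu i)) ℝ
  Phi : Matrix (Σ i, Fin (nv i)) (Σ i, Fin (nz i)) ℝ

namespace NetworkedSystem

variable {N : ℕ} {nx nu nv ny nz : Fin N → ℕ}

/-- Well-posedness: `I - Φ diag(A_SS(1), …, A_SS(N))` is invertible. -/
def WellPosed (S : NetworkedSystem nx nu nv ny nz) : Prop :=
  IsUnit (1 - S.Phi * Matrix.blockDiagonal' S.ASS)

/-- Every row of the subsystem connection matrix has exactly one nonzero entry, equal to one. -/
def IsSelection (S : NetworkedSystem nx nu nv ny nz) : Prop :=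
  ∀ p, ∃ q, S.Phi p q = 1 ∧ ∀ q', q' ≠ q → S.Phi p q' = 0

/-- The signals `x`, `u`, `v`, `z`, `y` satisfy the subsystem equations and `v(t) = Φ z(t)` at all
times `t = 0, 1, 2, …`. -/
structure IsTrajectory (S : NetworkedSystem nx nu nv ny nz)
    (x : ℕ → ∀ i, Fin (nx i) → ℝ) (u : ℕ → ∀ i, Fin (nu i) → ℝ)
    (v : ℕ → ∀ i, Fin (nv i) → ℝ) (z : ℕ → ∀ i, Fin (nz i) → ℝ)
    (y : ℕ → ∀ i, Fin (ny i) → ℝ) : Prop where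
  state : ∀ t i, x (t + 1) i = S.ATT i *ᵥ x t i + S.ATS i *ᵥ v t i + S.BT i *ᵥ u t i
  internal : ∀ t i, z t i = S.AST i *ᵥ x t i + S.ASS i *ᵥ v t i + S.BS i *ᵥ u t i
  external : ∀ t i, y t i = S.CT i *ᵥ x t i + S.CS i *ᵥ v t i + S.D i *ᵥ u t i
  connection : ∀ t i k, v t i k = ∑ q : Σ j, Fin (nz j), S.Phi ⟨i, k⟩ q * z t q.1 q.2

/-- Observability of the whole system: the external inputs and external outputs over all times
determine the initial state. -/
def Observable (S : NetworkedSystem nx nu nv ny nz) : Prop :=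
  ∀ x u v z y x' v' z', S.IsTrajectory x u v z y → S.IsTrajectory x' u v' z' y → x 0 = x' 0

/-- Controllability of the whole system: by means of the external inputs every initial state can be
steered to every final state in finite time. -/
def Controllable (S : NetworkedSystem nx nu nv ny nz) : Prop :=
  ∀ a b : ∀ i, Fin (nx i) → ℝ, ∃ (T : ℕ) (x : ℕ → ∀ i, Fin (nx i) → ℝ)
    (u : ℕ → ∀ i, Fin (nu i) → ℝ) (v : ℕ → ∀ i, Fin (nv i) → ℝ)
    (z : ℕ → ∀ i, Fin (nz i) → ℝ) (y : ℕ → ∀ i, Fin (ny i) → ℝ),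
    S.IsTrajectory x u v z y ∧ x 0 = a ∧ x T = b

end NetworkedSystem

/-!
Necessity. If `w` is a complex eigenvector of `A_TT(i)` killed by `C_T(i)` and `A_ST(i)`, the real
parts of the motions `μ ^ t * w` of subsystem `i` are invisible to all other signals, so an
observable network has none; hence the eigenspace embeds in `ℂ ^ (m_y + m_z)`. Dually, a left
eigenvector killed by `B_T(i)` and `A_TS(i)` is a coordinate of the state that no input can move
away from `0`.

Sufficiency, controllability. All networks built here have `A_SS = 0`, so they are well-posed and
`x(t + 1)` is an explicit linear function `step` of `x(t)` and `u(t)`; the network is controllable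
as soon as the only subspace of states closed under `step` is the whole space. Three facts are used.

* A real matrix admits `m` real, nonzero input columns making it controllable when `m` is at least
  the maximal geometric multiplicity (`exists_columns_generating`). By the Popov-Belevitch-Hautus
  test the columns have to separate the left eigenspaces; they are picked one at a time outside a
  finite union of proper subspaces, each lowering the dimension of what is left of every eigenspace.
* Given `A` and a nonzero space `U` of inputs, some functional `f` vanishes along
  the Krylov filtration of `U` until its very last step (`exists_probe`). So whatever direction `g`
  is driven by `f` becomes reachable. Applied inside one subsystem this is Heymann's
  lemma: all input columns but some chosen drive columns can be used up for state feedback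
  (`exists_feedback`). Applied between two subsystems it makes a cascade controllable, with no
  condition on the spectra.
* Each internal input may be fed by an internal output made for it
  (`NetworkedSystem.exists_dedicated_network`).

A subsystem with external inputs uses them as its drive columns; one without has an
internal input (its maximal geometric multiplicity is positive unless it has no state), the first of
which is the drive column. The other internal inputs carry feedback of the own
state. The subsystems without external inputs are then arranged in a chain that starts at
a subsystem with one, each driven by the functional `f` of its predecessor.

Sufficiency, observability. As every internal output feeds exactly one internal input, `Φ` is a
permutation matrix, so transposing all matrices gives a legitimate network again, and it is
observable (`NetworkedSystem.StepReachable.dual_observable`).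
-/

/-! ### Real input columns separating the eigenspaces -/

theorem finrank_ker_le_of_notMem {K V : Type*} [Field K] [AddCommGroup V] [Module K V]
    [FiniteDimensional K V] {m : ℕ} {E : Submodule K V} (hE : Module.finrank K E ≤ m + 1)
    (φ : V →ₗ[K] K) (hφ : E = ⊥ ∨ ∃ w ∈ E, φ w ≠ 0) :
    Module.finrank K (E ⊓ LinearMap.ker φ : Submodule K V) ≤ m := by
  rcases hφ with rfl | ⟨w, hw, hφw⟩
  · rw [bot_inf_eq, finrank_bot]
    exact Nat.zero_le m
  · have : E ⊓ LinearMap.ker φ < E := by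
      refine lt_of_le_of_ne inf_le_left fun h => hφw ?_
      exact (h.ge hw).2
    have := Submodule.finrank_lt_finrank_of_lt this
    omega

/-- The vectors orthogonal to a given nonzero complex vector form a proper real subspace, and
finitely many proper subspaces do not cover the space. -/
theorem exists_real_vector {n : ℕ} (hn : 0 < n) {ι : Type*} (Λ : Finset ι) (w : ι → Fin n → ℂ)
    (hw : ∀ l ∈ Λ, w l ≠ 0) :
    ∃ b : Fin n → ℝ, b ≠ 0 ∧ ∀ l ∈ Λ, w l ⬝ᵥ (fun i => (b i : ℂ)) ≠ 0 := by
  classical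
  -- the real-linear pairing with `w`
  let ev : (Fin n → ℂ) → (Fin n → ℝ) →ₗ[ℝ] ℂ := fun w =>
    { toFun := fun b => w ⬝ᵥ (fun i => (b i : ℂ))
      map_add' := fun x y => by
        simp only [dotProduct, ← Finset.sum_add_distrib, Pi.add_apply, Complex.ofReal_add, mul_add]
      map_smul' := fun c x => by
        simp only [dotProduct, Pi.smul_apply, smul_eq_mul, Complex.ofReal_mul, RingHom.id_apply,
          Complex.real_smul, Finset.mul_sum, mul_left_comm] }
  -- `none` stands for the zero subspace, which makes the chosen vector nonzero
  have hproper : ∀ o ∈ insert none (Λ.image some),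
      (o.elim ⊥ fun l => LinearMap.ker (ev (w l)) : Submodule ℝ (Fin n → ℝ)) ≠ ⊤ := by
    intro o ho htop
    rcases o with _ | l
    · have : (fun _ => 1 : Fin n → ℝ) ∈ (⊥ : Submodule ℝ (Fin n → ℝ)) := by
        rw [show (⊥ : Submodule ℝ (Fin n → ℝ)) = ⊤ from htop]; trivial
      have := congrFun ((Submodule.mem_bot ℝ).1 this) ⟨0, hn⟩
      simp at this
    · have hl : l ∈ Λ := by simpa using ho
      refine hw l hl (funext fun i => ?_)
      have : Pi.single i 1 ∈ LinearMap.ker (ev (w l)) := by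
        rw [show LinearMap.ker (ev (w l)) = ⊤ from htop]; trivial
      have h2 : w l ⬝ᵥ (fun j => ((Pi.single i 1 : Fin n → ℝ) j : ℂ)) = 0 := this
      rw [show (fun j => ((Pi.single i 1 : Fin n → ℝ) j : ℂ)) = Pi.single i 1 by
        ext j; by_cases h : j = i <;> simp [h]] at h2
      simpa using h2
  have := Subspace.biUnion_ne_univ_of_top_notMem (k := ℝ) (E := Fin n → ℝ)
    (s := (insert none (Λ.image some)).image fun o : Option ι =>
      (o.elim ⊥ fun l => LinearMap.ker (ev (w l)) : Submodule ℝ (Fin n → ℝ)))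
    (by
      simp only [Finset.mem_image, not_exists, not_and]
      exact hproper)
  obtain ⟨b, hb⟩ := (Set.ne_univ_iff_exists_notMem _).1 this
  simp only [Finset.mem_image, Set.mem_iUnion, not_exists] at hb
  refine ⟨b, fun h => hb ⊥ ⟨none, by simp, rfl⟩ (by simp [h]), fun l hl h => ?_⟩
  exact hb _ ⟨some l, by simp [hl], rfl⟩ h

/-- Finitely many complex subspaces of dimension at most `m` are simultaneously separated by `m`
nonzero real vectors. -/
theorem exists_real_columns {n : ℕ} (hn : 0 < n) {ι : Type*} (Λ : Finset ι) (m : ℕ)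
    (E : ι → Submodule ℂ (Fin n → ℂ)) (hE : ∀ l ∈ Λ, Module.finrank ℂ (E l) ≤ m) :
    ∃ b : Fin m → Fin n → ℝ, (∀ k, b k ≠ 0) ∧
      ∀ l ∈ Λ, ∀ w ∈ E l, (∀ k, w ⬝ᵥ (fun i => (b k i : ℂ)) = 0) → w = 0 := by
  classical
  induction m generalizing E with
  | zero =>
    refine ⟨Fin.elim0, fun k => k.elim0, fun l hl w hw _ => ?_⟩
    have : E l = ⊥ := Submodule.finrank_eq_zero.1 (Nat.le_zero.1 (hE l hl))
    simpa [this] using hw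
  | succ m ih =>
    have : ∀ l, ∃ w, E l ≠ ⊥ → w ∈ E l ∧ w ≠ 0 := fun l => by
      by_cases h : E l = ⊥
      · exact ⟨0, fun h' => (h' h).elim⟩
      · obtain ⟨w, hw⟩ := Submodule.exists_mem_ne_zero_of_ne_bot h
        exact ⟨w, fun _ => hw⟩
    choose w hw using this
    -- the first vector pairs nontrivially with a vector of each nonzero subspace
    obtain ⟨b, hb0, hb⟩ := exists_real_vector hn (Λ.filter fun l => E l ≠ ⊥) w
      (fun l hl => (hw l (Finset.mem_filter.1 hl).2).2)
    let φ : (Fin n → ℂ) →ₗ[ℂ] ℂ := 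
      { toFun := fun w => w ⬝ᵥ (fun i => (b i : ℂ))
        map_add' := fun x y => add_dotProduct _ _ _
        map_smul' := fun c x => smul_dotProduct _ _ _ }
    obtain ⟨c, hc0, hc⟩ := ih (fun l => E l ⊓ LinearMap.ker φ) (fun l hl =>
      finrank_ker_le_of_notMem (hE l hl) φ (or_iff_not_imp_left.2 fun h =>
        ⟨w l, (hw l h).1, hb l (Finset.mem_filter.2 ⟨hl, h⟩)⟩))
    refine ⟨Fin.cons b c, fun k => ?_, fun l hl x hx h => ?_⟩
    · cases k using Fin.cases with
      | zero => simpa using hb0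
      | succ k => simpa using hc0 k
    · exact hc l hl x ⟨hx, h 0⟩ (fun k => by simpa using h k.succ)

theorem finrank_eigenspace_le_maxGeomMult {n : ℕ} (A : Matrix (Fin n) (Fin n) ℝ) (μ : ℂ) :
    Module.finrank ℂ (Module.End.eigenspace (Matrix.toLin' (A.map (algebraMap ℝ ℂ))) μ) ≤
      maxGeomMult A :=
  le_ciSup (maxGeomMult_bddAbove A) μ

theorem finrank_eigenspace_transpose {K : Type*} [Field K] {n : ℕ} (M : Matrix (Fin n) (Fin n) K)
    (μ : K) : Module.finrank K (Module.End.eigenspace (Matrix.toLin' Mᵀ) μ) =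
      Module.finrank K (Module.End.eigenspace (Matrix.toLin' M) μ) := by
  have key : ∀ M : Matrix (Fin n) (Fin n) K,
      Module.finrank K (Module.End.eigenspace (Matrix.toLin' M) μ)
        + (M - Matrix.scalar (Fin n) μ).rank = n := fun M => by
    have h := LinearMap.finrank_range_add_finrank_ker
      (Matrix.toLin' (M - Matrix.scalar (Fin n) μ))
    have e : Module.End.eigenspace (Matrix.toLin' M) μ =
        LinearMap.ker (Matrix.toLin' (M - Matrix.scalar (Fin n) μ)) := by
      ext x
      rw [Module.End.mem_eigenspace_iff, LinearMap.mem_ker, Matrix.toLin'_apply,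
        Matrix.toLin'_apply, Matrix.sub_mulVec, sub_eq_zero]
      simp
    rw [e, Matrix.rank, ← Matrix.toLin'_apply']
    simp at h ⊢
    omega
  have h1 := key M
  have h2 := key Mᵀ
  rw [← Matrix.rank_transpose (Mᵀ - _)] at h2
  simp only [Matrix.transpose_sub, Matrix.transpose_transpose, Matrix.scalar_apply,
    Matrix.diagonal_transpose] at h1 h2
  omega

theorem maxGeomMult_transpose {n : ℕ} (A : Matrix (Fin n) (Fin n) ℝ) :
    maxGeomMult Aᵀ = maxGeomMult A :=
  iSup_congr fun μ => finrank_eigenspace_transpose (A.map (algebraMap ℝ ℂ)) μ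

theorem maxGeomMult_pos {n : ℕ} (hn : 0 < n) (A : Matrix (Fin n) (Fin n) ℝ) :
    0 < maxGeomMult A := by
  have : Nonempty (Fin n) := ⟨⟨0, hn⟩⟩
  obtain ⟨μ, hμ⟩ := Module.End.exists_eigenvalue (Matrix.toLin' (A.map (algebraMap ℝ ℂ)))
  refine lt_of_lt_of_le ?_ (finrank_eigenspace_le_maxGeomMult A μ)
  exact Nat.pos_of_ne_zero fun h => hμ (Submodule.finrank_eq_zero.1 h)

/-- A real matrix `A` is made controllable by `m ≥ maxGeomMult A` nonzero real input columns.
Controllability is expressed by the absence of proper `A`-invariant subspaces that contain the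
columns. -/
theorem exists_columns_generating {n : ℕ} (hn : 0 < n) (A : Matrix (Fin n) (Fin n) ℝ) {m : ℕ}
    (hm : maxGeomMult A ≤ m) :
    ∃ b : Fin m → Fin n → ℝ, (∀ k, b k ≠ 0) ∧ ∀ W : Submodule ℝ (Fin n → ℝ),
      (∀ x ∈ W, A *ᵥ x ∈ W) → (∀ k, b k ∈ W) → W = ⊤ := by
  let T : Module.End ℂ (Fin n → ℂ) := Matrix.toLin' (Aᵀ.map (algebraMap ℝ ℂ))
  obtain ⟨b, hb0, hb⟩ := exists_real_columns hn (Module.End.finite_hasEigenvalue T).toFinset m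
    (fun μ => Module.End.eigenspace T μ) (fun μ _ =>
      (finrank_eigenspace_le_maxGeomMult Aᵀ μ).trans ((maxGeomMult_transpose A).trans_le hm))
  refine ⟨b, hb0, fun W hA hbW => ?_⟩
  by_contra hW
  -- the complex functionals that vanish on `W`
  let Q : Submodule ℂ (Fin n → ℂ) :=
    { carrier := {w | ∀ x ∈ W, w ⬝ᵥ (fun i => (x i : ℂ)) = 0}
      add_mem' := fun {a c} ha hc x hx => by rw [add_dotProduct, ha x hx, hc x hx, add_zero]
      zero_mem' := fun x _ => zero_dotProduct _
      smul_mem' := fun c a ha x hx => by rw [smul_dotProduct, ha x hx, smul_zero] }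
  have hQ : ∀ w ∈ Q, T w ∈ Q := fun w hw x hx => by
    have h := hw _ (hA x hx)
    have e : (fun i => ((A *ᵥ x) i : ℂ)) = A.map (algebraMap ℝ ℂ) *ᵥ fun i => (x i : ℂ) := by
      ext i; simp [Matrix.mulVec, dotProduct]
    rw [e, Matrix.dotProduct_mulVec] at h
    simpa [T, Matrix.transpose_map, Matrix.mulVec_transpose] using h
  have hQ0 : Nontrivial Q := by
    obtain ⟨x, hx⟩ : ∃ x, x ∉ W := by
      by_contra! h
      exact hW (Submodule.eq_top_iff'.2 h)
    obtain ⟨f, hfx, hf⟩ := Submodule.exists_dual_map_eq_bot_of_notMem hx inferInstance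
    have hfW : ∀ y ∈ W, f y = 0 := fun y hy => by
      have : f y ∈ W.map f := ⟨y, hy, rfl⟩
      simpa [hf] using this
    have hf' : ∀ y, ∑ i, f (Pi.single i 1) * y i = f y := fun y => by
      conv_rhs => rw [← Finset.univ_sum_single y, map_sum]
      refine Finset.sum_congr rfl fun i _ => ?_
      rw [mul_comm, ← smul_eq_mul, ← map_smul, ← Pi.single_smul, smul_eq_mul, mul_one]
    refine ⟨⟨⟨fun i => (f (Pi.single i 1) : ℂ), fun y hy => ?_⟩, 0, fun h => hfx ?_⟩⟩
    · have := (hf' y).trans (hfW y hy)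
      simp only [dotProduct]
      exact_mod_cast this
    · rw [← hf' x]
      refine Finset.sum_eq_zero fun i _ => ?_
      have := congrFun (congrArg Subtype.val h) i
      have : f (Pi.single i 1) = 0 := by simpa using this
      rw [this, zero_mul]
  obtain ⟨μ, hμ⟩ := Module.End.exists_eigenvalue (T.restrict hQ)
  obtain ⟨w, hw⟩ := hμ.exists_hasEigenvector
  have hw0 : (w : Fin n → ℂ) ≠ 0 := fun h => hw.2 (Subtype.ext h)
  have hTw : T w = μ • (w : Fin n → ℂ) := congrArg Subtype.val hw.apply_eq_smul
  have hE : (w : Fin n → ℂ) ∈ Module.End.eigenspace T μ := Module.End.mem_eigenspace_iff.2 hTw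
  refine hw0 (hb μ ?_ w hE fun k => w.2 _ (hbW k))
  simpa using Module.End.hasEigenvalue_of_hasEigenvector ⟨hE, hw0⟩

/-! ### State feedback and cascades -/

/-- A functional `f` of the state of a system `A` with input space `U` such that every direction `g`
that `f` drives, in any larger system containing this one, is reachable. -/
theorem exists_probe {K V : Type*} [Field K] [AddCommGroup V] [Module K V]
    [FiniteDimensional K V] (A : V →ₗ[K] V) {U : Submodule K V} (hU : U ≠ ⊥) :
    ∃ f : V →ₗ[K] K, ∀ {Y : Type} [AddCommGroup Y] [Module K Y] (W : Submodule K Y)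
      (ι : V →ₗ[K] Y) (g : Y), (∀ x, ι x ∈ W → ι (A x) + f x • g ∈ W) →
      (∀ x ∈ U, ι x ∈ W) → g ∈ W := by
  classical
  -- the states reachable within `k` steps
  let R : ℕ → Submodule K V := fun k => (fun P => U ⊔ P.map A)^[k] ⊥
  have hR : ∀ k, R (k + 1) = U ⊔ (R k).map A := fun k =>
    Function.iterate_succ_apply' _ k ⊥
  have hmono : Monotone R := monotone_nat_of_le_succ fun k => by
    induction k with
    | zero => exact bot_le
    | succ k ih => rw [hR, hR (k + 1)]; exact sup_le_sup_left (Submodule.map_mono ih) _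
  have hex : ∃ k : ℕ, R k = R (k + 1) := by
    obtain ⟨k, hk⟩ := WellFoundedGT.monotone_chain_condition ⟨R, hmono⟩
    exact ⟨k, hk (k + 1) k.le_succ⟩
  obtain ⟨k, hk, hmin⟩ :=
    (wellFounded_lt (α := ℕ)).has_min {k | R k = R (k + 1)} hex
  obtain ⟨j, rfl⟩ : ∃ j : ℕ, k = j + 1 := Nat.exists_eq_succ_of_ne_zero fun h => hU (by
    rw [h, Set.mem_ofPred_eq, hR] at hk
    simpa [R] using hk.symm)
  have hlt : R j < R (j + 1) := lt_of_le_of_ne (hmono j.le_succ)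
    fun h => hmin j h j.lt_succ_self
  obtain ⟨x, hx, hxj⟩ := SetLike.exists_of_lt hlt
  obtain ⟨f, hfx, hf⟩ := Submodule.exists_dual_map_eq_bot_of_notMem hxj inferInstance
  have hfR : ∀ y ∈ R j, f y = 0 := fun y hy => by
    have : f y ∈ (R j).map f := ⟨y, hy, rfl⟩
    rwa [hf, Submodule.mem_bot] at this
  -- `f` vanishes on `R j`, hence does not disturb the states reached until then; the
  -- next step of `x` stays in `R (j + 1)` and differs from the driven one by `f x • g`
  refine ⟨f, fun {Y} _ _ W ι g hW hUW => ?_⟩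
  have hRW : ∀ i, i ≤ j + 1 → R i ≤ W.comap ι := fun i => by
    induction i with
    | zero => exact fun _ => bot_le
    | succ i ih =>
      intro hi
      rw [hR]
      refine sup_le hUW ?_
      rintro _ ⟨y, hy, rfl⟩
      have := hW y (ih (by omega) hy)
      rwa [hfR y (hmono (by omega) hy), zero_smul, add_zero] at this
  have hAx : A x ∈ R (j + 1) := by
    rw [hk, hR]
    exact Submodule.mem_sup_right ⟨x, hx, rfl⟩
  have h1 := W.sub_mem (hW x (hRW _ le_rfl hx)) (hRW _ le_rfl hAx)
  rw [add_sub_cancel_left] at h1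
  exact (W.smul_mem_iff hfx).1 h1

/-- Heymann's lemma: if `A` is controllable from `U` and the columns `H k` together, then state
feedback into the columns makes it controllable from `U` alone. -/
theorem exists_feedback {V κ : Type} [AddCommGroup V] [Module ℝ V] [FiniteDimensional ℝ V]
    [DecidableEq κ] (S : Finset κ) (H : κ → V) {U : Submodule ℝ V} (hU : U ≠ ⊥) (A : V →ₗ[ℝ] V)
    (hA : ∀ W : Submodule ℝ V, (∀ x ∈ W, A x ∈ W) → U ≤ W → (∀ k ∈ S, H k ∈ W) → W = ⊤) :
    ∃ F : κ → V →ₗ[ℝ] ℝ, ∀ W : Submodule ℝ V,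
      (∀ x ∈ W, A x + ∑ k ∈ S, F k x • H k ∈ W) → U ≤ W → W = ⊤ := by
  induction S using Finset.induction_on generalizing A with
  | empty => exact ⟨0, fun W h1 h2 => hA W (by simpa using h1) h2 (by simp)⟩
  | insert a S ha ih =>
    obtain ⟨f, hf⟩ := exists_probe A hU
    obtain ⟨F, hF⟩ := ih (A + f.smulRight (H a)) fun W h1 h2 h3 => by
      have ha : H a ∈ W := hf W LinearMap.id (H a) (fun x hx => by simpa using h1 x hx) h2
      refine hA W (fun x hx => ?_) h2 fun k hk => ?_
      · simpa using W.sub_mem (h1 x hx) (W.smul_mem (f x) ha)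
      · rcases Finset.mem_insert.1 hk with rfl | hk
        exacts [ha, h3 k hk]
    refine ⟨Function.update F a f, fun W h1 h2 => hF W (fun x hx => ?_) h2⟩
    have := h1 x hx
    rw [Finset.sum_insert ha, Function.update_self] at this
    rw [Finset.sum_congr rfl (g := fun k => F k x • H k) fun k hk => by
      rw [Function.update_of_ne (ne_of_mem_of_not_mem hk ha)]] at this
    simpa [add_assoc] using this

/-- The drive columns among the `m₂` internal inputs of a subsystem with `m₁` external inputs: none
if `m₁` is positive, and the first one otherwise. -/
def IsDrive (m₁ : ℕ) {m₂ : ℕ} (k : Fin m₂) : Prop := m₁ = 0 ∧ (k : ℕ) = 0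

theorem exists_functional_eq_dotProduct {n : ℕ} (f : (Fin n → ℝ) →ₗ[ℝ] ℝ) :
    ∃ a : Fin n → ℝ, ∀ x, f x = a ⬝ᵥ x := by
  refine ⟨fun i => f (Pi.single i 1), fun x => ?_⟩
  conv_lhs => rw [← Finset.univ_sum_single x, map_sum]
  refine Finset.sum_congr rfl fun i _ => ?_
  rw [mul_comm, ← smul_eq_mul, ← map_smul, ← Pi.single_smul, smul_eq_mul, mul_one]

/-- The design of a single subsystem: external and internal input columns `B` and `G`, a feedback
`F` into the internal inputs that are not drive columns, and a functional `f` for driving the next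
subsystem. In any larger system that contains this closed loop through `ι` and is driven by `f`
along `g`, a closed subspace with the columns of `B` and the drive columns contains all states of
the subsystem and, unless there are none but `0`, also `g`. -/
theorem exists_local_design {n m₁ m₂ : ℕ} (A : Matrix (Fin n) (Fin n) ℝ)
    (h : maxGeomMult A ≤ m₁ + m₂) :
    ∃ (B : Matrix (Fin n) (Fin m₁) ℝ) (G : Matrix (Fin n) (Fin m₂) ℝ) (F : Fin m₂ → Fin n → ℝ)
      (f : Fin n → ℝ), (∀ k, IsDrive m₁ k → F k = 0) ∧
      ∀ {Y : Type} [AddCommGroup Y] [Module ℝ Y] (W : Submodule ℝ Y)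
        (ι : (Fin n → ℝ) →ₗ[ℝ] Y) (g : Y),
        (∀ x, ι x ∈ W → ι (A *ᵥ x + G *ᵥ fun k => F k ⬝ᵥ x) + (f ⬝ᵥ x) • g ∈ W) →
        (∀ k, ι (B.col k) ∈ W) → (∀ k, IsDrive m₁ k → ι (G.col k) ∈ W) →
        (∀ x, ι x ∈ W) ∧ (0 < n → g ∈ W) := by
  classical
  rcases Nat.eq_zero_or_pos n with rfl | hn
  · refine ⟨0, 0, 0, 0, fun _ _ => rfl, fun {Y} _ _ W ι g _ _ _ => ⟨fun x => ?_, by simp⟩⟩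
    rw [Subsingleton.elim x 0, map_zero]
    exact W.zero_mem
  obtain ⟨b, hb0, hb⟩ := exists_columns_generating hn A h
  let B : Fin m₁ → Fin n → ℝ := fun k => b (Fin.castAdd m₂ k)
  let G : Fin m₂ → Fin n → ℝ := fun k => b (Fin.natAdd m₁ k)
  let s : Set (Fin n → ℝ) := Set.range B ∪ G '' {k | IsDrive m₁ k}
  have hU : Submodule.span ℝ s ≠ ⊥ := by
    have hpos := maxGeomMult_pos hn A
    obtain ⟨v, hv, hv0⟩ : ∃ v ∈ s, v ≠ 0 := by
      rcases Nat.eq_zero_or_pos m₁ with h0 | h1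
      · exact ⟨G ⟨0, by omega⟩, Or.inr ⟨_, ⟨h0, rfl⟩, rfl⟩, hb0 _⟩
      · exact ⟨B ⟨0, h1⟩, Or.inl ⟨_, rfl⟩, hb0 _⟩
    exact fun h => hv0 ((Submodule.mem_bot ℝ).1 (h ▸ Submodule.subset_span hv))
  obtain ⟨F, hF⟩ := exists_feedback (Finset.univ.filter fun k => ¬ IsDrive m₁ k) G hU
    (Matrix.toLin' A) fun W h1 h2 h3 => hb W h1 fun k => by
      induction k using Fin.addCases with
      | left k => exact h2 (Submodule.subset_span (Or.inl ⟨k, rfl⟩))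
      | right k =>
        by_cases hk : IsDrive m₁ k
        · exact h2 (Submodule.subset_span (Or.inr ⟨k, hk, rfl⟩))
        · exact h3 k (by simpa using hk)
  choose F' hF' using fun k => exists_functional_eq_dotProduct (F k)
  let F₀ : Fin m₂ → Fin n → ℝ := fun k => if IsDrive m₁ k then 0 else F' k
  let T : (Fin n → ℝ) →ₗ[ℝ] (Fin n → ℝ) :=
    Matrix.toLin' (A + (Matrix.of G)ᵀ * Matrix.of F₀)
  have hT : ∀ x, T x = A *ᵥ x + (Matrix.of G)ᵀ *ᵥ fun k => F₀ k ⬝ᵥ x := fun x => by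
    simp only [T, Matrix.toLin'_apply, Matrix.add_mulVec, ← Matrix.mulVec_mulVec]
    rfl
  have hTF : ∀ x, Matrix.toLin' A x +
      ∑ k ∈ Finset.univ.filter (fun k => ¬ IsDrive m₁ k), F k x • G k = T x := fun x => by
    rw [hT, Matrix.toLin'_apply, Finset.sum_filter]
    congr 1
    ext i
    simp only [Finset.sum_apply, Matrix.mulVec, dotProduct, Matrix.transpose_apply, Matrix.of_apply]
    refine Finset.sum_congr rfl fun k _ => ?_
    by_cases hk : IsDrive m₁ k
    · simp [F₀, hk]
    · simp [F₀, hk, hF', dotProduct, mul_comm (G k i)]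
  obtain ⟨f, hf⟩ := exists_probe T hU
  obtain ⟨f', hf'⟩ := exists_functional_eq_dotProduct f
  refine ⟨(Matrix.of B)ᵀ, (Matrix.of G)ᵀ, F₀, f', fun k hk => if_pos hk,
    fun {Y} _ _ W ι g h1 h2 h3 => ?_⟩
  have hUW : Submodule.span ℝ s ≤ W.comap ι := by
    refine Submodule.span_le.2 ?_
    rintro _ (⟨k, rfl⟩ | ⟨k, hk, rfl⟩)
    exacts [h2 k, h3 k hk]
  have hg : g ∈ W := hf W ι g (fun x hx => by simpa only [hT, hf'] using h1 x hx) hUW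
  refine ⟨Submodule.eq_top_iff'.1 (hF (W.comap ι) (fun x hx => ?_) hUW), fun _ => hg⟩
  have h4 := W.sub_mem (h1 x hx) (W.smul_mem (f' ⬝ᵥ x) hg)
  rw [add_sub_cancel_right, ← hT, ← hTF] at h4
  exact h4

/-- The elements of `T` can be lined up behind `r`: `pred` is the preceding element. The last
conjunct is induction along the chain. -/
theorem exists_chain {α : Type*} [DecidableEq α] (r : α) (T : Finset α) (hr : r ∉ T) :
    ∃ pred : α → α, Set.InjOn pred T ∧ (∀ i ∈ T, pred i ∈ insert r T) ∧
      ∀ P : α → Prop, P r → (∀ i ∈ T, P (pred i) → P i) → ∀ i ∈ T, P i := by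
  -- `l` is the end of the chain, where the next element is attached
  suffices ∃ (pred : α → α) (l : α), l ∈ insert r T ∧ (∀ i ∈ T, pred i ≠ l) ∧
      Set.InjOn pred T ∧ (∀ i ∈ T, pred i ∈ insert r T) ∧
      ∀ P : α → Prop, P r → (∀ i ∈ T, P (pred i) → P i) → ∀ i ∈ T, P i by
    obtain ⟨pred, _, _, _, h⟩ := this
    exact ⟨pred, h⟩
  induction T using Finset.induction_on with
  | empty => exact ⟨id, r, by simp, by simp, by simp, by simp, by simp⟩
  | insert a T ha ih =>
    obtain ⟨pred, l, hl, hpl, hinj, hpT, hP⟩ := ih fun h => hr (Finset.mem_insert_of_mem h)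
    have hne : ∀ i ∈ T, i ≠ a := fun i hi => ne_of_mem_of_not_mem hi ha
    have har : a ∉ insert r T := by
      rw [Finset.mem_insert, not_or]
      exact ⟨fun h => hr (h ▸ Finset.mem_insert_self a T), ha⟩
    have hsub : insert r T ⊆ insert r (insert a T) :=
      Finset.insert_subset_insert _ (Finset.subset_insert _ _)
    refine ⟨Function.update pred a l, a, by simp, ?_, ?_, ?_, ?_⟩
    · rintro i hi
      rcases Finset.mem_insert.1 hi with rfl | hi
      · rw [Function.update_self]
        exact ne_of_mem_of_not_mem hl har
      · rw [Function.update_of_ne (hne i hi)]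
        exact ne_of_mem_of_not_mem (hpT i hi) har
    · rintro i hi j hj hij
      rcases Finset.mem_insert.1 (Finset.mem_coe.1 hi) with hia | hi' <;>
        rcases Finset.mem_insert.1 (Finset.mem_coe.1 hj) with hja | hj'
      · rw [hia, hja]
      · rw [hia, Function.update_self, Function.update_of_ne (hne j hj')] at hij
        exact (hpl j hj' hij.symm).elim
      · rw [hja, Function.update_self, Function.update_of_ne (hne i hi')] at hij
        exact (hpl i hi' hij).elim
      · rw [Function.update_of_ne (hne i hi'), Function.update_of_ne (hne j hj')] at hij
        exact hinj hi' hj' hij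
    · intro i hi
      rcases Finset.mem_insert.1 hi with rfl | hi
      · rw [Function.update_self]
        exact hsub hl
      · rw [Function.update_of_ne (hne i hi)]
        exact hsub (hpT i hi)
    · intro P hPr hPs
      have hT : ∀ i ∈ T, P i := hP P hPr fun i hi h =>
        hPs i (Finset.mem_insert_of_mem hi) (by rwa [Function.update_of_ne (hne i hi)])
      intro i hi
      rcases Finset.mem_insert.1 hi with rfl | hi
      · refine hPs i hi ?_
        rw [Function.update_self]
        rcases Finset.mem_insert.1 hl with rfl | hl
        exacts [hPr, hT l hl]
      · exact hT i hi

/-! ### Necessity of the dimension bounds -/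

theorem finrank_le_of_injOn_mulVec {a b c : Type*} [Fintype a] [Fintype b] [Fintype c]
    (M : Matrix b a ℝ) (M' : Matrix c a ℝ) (E : Submodule ℂ (a → ℂ))
    (h : ∀ w ∈ E, M.map (algebraMap ℝ ℂ) *ᵥ w = 0 → M'.map (algebraMap ℝ ℂ) *ᵥ w = 0 → w = 0) :
    Module.finrank ℂ E ≤ Fintype.card b + Fintype.card c := by
  let φ : (a → ℂ) →ₗ[ℂ] (b → ℂ) × (c → ℂ) :=
    (M.map (algebraMap ℝ ℂ)).mulVecLin.prod (M'.map (algebraMap ℝ ℂ)).mulVecLin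
  have hinj : Function.Injective (φ.domRestrict E) := by
    rw [← LinearMap.ker_eq_bot, LinearMap.ker_eq_bot']
    intro w hw
    exact Subtype.ext (h w w.2 (congrArg Prod.fst hw) (congrArg Prod.snd hw))
  simpa using LinearMap.finrank_le_finrank_of_injective hinj

theorem map_ofReal_mulVec {a b : Type*} [Fintype a] (M : Matrix b a ℝ) (x : a → ℝ) :
    (M.map (algebraMap ℝ ℂ) *ᵥ fun i => (x i : ℂ)) = fun i => ((M *ᵥ x) i : ℂ) := by
  ext i
  simp [Matrix.mulVec, dotProduct]

theorem re_mulVec {a b : Type*} [Fintype a] (M : Matrix b a ℝ) (w : a → ℂ) :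
    (M *ᵥ fun i => (w i).re) = fun i => ((M.map (algebraMap ℝ ℂ) *ᵥ w) i).re := by
  ext i
  simp [Matrix.mulVec, dotProduct]

namespace NetworkedSystem

variable {N : ℕ} {nx nu nv ny nz : Fin N → ℕ}

/-- A mode of one subsystem that appears in neither of its outputs is a motion of the network with
all other signals zero. -/
theorem isTrajectory_single_mode (S : NetworkedSystem nx nu nv ny nz) (i : Fin N) {μ : ℂ}
    {w : Fin (nx i) → ℂ} (hw : (S.ATT i).map (algebraMap ℝ ℂ) *ᵥ w = μ • w)
    (hC : (S.CT i).map (algebraMap ℝ ℂ) *ᵥ w = 0) (hZ : (S.AST i).map (algebraMap ℝ ℂ) *ᵥ w = 0) :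
    S.IsTrajectory (fun t => Pi.single i fun k => (μ ^ t * w k).re) 0 0 0 0 := by
  have key : ∀ (m : ℕ) (M : Matrix (Fin m) (Fin (nx i)) ℝ) (t : ℕ),
      (M *ᵥ fun k => (μ ^ t * w k).re) =
        fun k => (μ ^ t * (M.map (algebraMap ℝ ℂ) *ᵥ w) k).re := fun m M t => by
    have := re_mulVec M (μ ^ t • w)
    simpa [Matrix.mulVec_smul] using this
  refine ⟨fun t j => ?_, fun t j => ?_, fun t j => ?_, fun t j k => by simp⟩
  · by_cases h : j = i
    · subst h
      simp only [Pi.single_eq_same, key, hw]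
      simp [pow_succ, mul_assoc]
    · simp [h]
  · by_cases h : j = i
    · subst h
      simp only [Pi.single_eq_same, key, hZ]
      simp
      rfl
    · simp [h]
  · by_cases h : j = i
    · subst h
      simp only [Pi.single_eq_same, key, hC]
      simp
      rfl
    · simp [h]

theorem isTrajectory_zero (S : NetworkedSystem nx nu nv ny nz) : S.IsTrajectory 0 0 0 0 0 := by
  refine ⟨fun t j => ?_, fun t j => ?_, fun t j => ?_, fun t j k => ?_⟩ <;> simp

theorem Observable.maxGeomMult_le {S : NetworkedSystem nx nu nv ny nz} (hS : S.Observable)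
    (i : Fin N) : maxGeomMult (S.ATT i) ≤ ny i + nz i := by
  refine ciSup_le fun μ => ?_
  have h := finrank_le_of_injOn_mulVec (S.CT i) (S.AST i)
    (Module.End.eigenspace (Matrix.toLin' ((S.ATT i).map (algebraMap ℝ ℂ))) μ)
  simp only [Fintype.card_fin] at h
  refine h fun w hw hC hZ => ?_
  have hw' : (S.ATT i).map (algebraMap ℝ ℂ) *ᵥ w = μ • w := by
    simpa using Module.End.mem_eigenspace_iff.1 hw
  -- multiplying `w` by `1` and by `I` gives its real and imaginary part
  have hre : ∀ c : ℂ, ∀ k, (c * w k).re = 0 := fun c k => by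
    have h1 := hS _ _ _ _ _ _ _ _ (isTrajectory_single_mode S i (μ := μ) (w := c • w)
      (by rw [Matrix.mulVec_smul, hw', smul_comm]) (by rw [Matrix.mulVec_smul, hC, smul_zero])
      (by rw [Matrix.mulVec_smul, hZ, smul_zero])) S.isTrajectory_zero
    simpa using congrFun (congrFun h1 i) k
  ext k
  apply Complex.ext
  · simpa using hre 1 k
  · simpa using hre Complex.I k

theorem Controllable.maxGeomMult_le {S : NetworkedSystem nx nu nv ny nz} (hS : S.Controllable)
    (i : Fin N) : maxGeomMult (S.ATT i) ≤ nu i + nv i := by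
  rw [← maxGeomMult_transpose]
  refine ciSup_le fun μ => ?_
  have h := finrank_le_of_injOn_mulVec (S.BT i)ᵀ (S.ATS i)ᵀ
    (Module.End.eigenspace (Matrix.toLin' ((S.ATT i)ᵀ.map (algebraMap ℝ ℂ))) μ)
  simp only [Fintype.card_fin] at h
  refine h fun w hw hB hG => ?_
  have hw' : w ᵥ* (S.ATT i).map (algebraMap ℝ ℂ) = μ • w := by
    rw [← Matrix.mulVec_transpose]
    exact Module.End.mem_eigenspace_iff.1 hw
  have hB' : w ᵥ* (S.BT i).map (algebraMap ℝ ℂ) = 0 := by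
    rw [← Matrix.mulVec_transpose]
    exact hB
  have hG' : w ᵥ* (S.ATS i).map (algebraMap ℝ ℂ) = 0 := by
    rw [← Matrix.mulVec_transpose]
    exact hG
  ext k
  obtain ⟨T, x, u, v, z, y, hx, h0, hT⟩ := hS 0 (Pi.single i (Pi.single k 1))
  -- the coordinate of the state along a left eigenvector that the inputs cannot reach stays zero
  have hzero : ∀ t, w ⬝ᵥ (fun l => (x t i l : ℂ)) = 0 := fun t => by
    induction t with
    | zero => simp [h0, dotProduct]
    | succ t ih =>
      have e : (fun l => (x (t + 1) i l : ℂ)) =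
          (S.ATT i).map (algebraMap ℝ ℂ) *ᵥ (fun l => (x t i l : ℂ)) +
          (S.ATS i).map (algebraMap ℝ ℂ) *ᵥ (fun l => (v t i l : ℂ)) +
          (S.BT i).map (algebraMap ℝ ℂ) *ᵥ (fun l => (u t i l : ℂ)) := by
        rw [map_ofReal_mulVec, map_ofReal_mulVec, map_ofReal_mulVec, hx.state]
        ext l
        simp
      rw [e, dotProduct_add, dotProduct_add, Matrix.dotProduct_mulVec, Matrix.dotProduct_mulVec,
        Matrix.dotProduct_mulVec, hw', hB', hG', smul_dotProduct, ih]
      simp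
  have h1 := hzero T
  rw [hT, Pi.single_eq_same, show (fun l => ((Pi.single k 1 : Fin (nx i) → ℝ) l : ℂ)) =
    Pi.single k 1 by ext l; by_cases h : l = k <;> simp [h], dotProduct_single_one] at h1
  exact h1

/-! ### The state space of a network without direct internal feedthrough -/

/-- The state at the next time in terms of the state and the external input, in a network with
`A_SS = 0`; for other networks this is not the actual next state. -/
noncomputable def step (S : NetworkedSystem nx nu nv ny nz) :
    (∀ i, Fin (nx i) → ℝ) × (∀ i, Fin (nu i) → ℝ) →ₗ[ℝ] (∀ i, Fin (nx i) → ℝ) where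
  toFun p i := S.ATT i *ᵥ p.1 i + S.ATS i *ᵥ (fun k => ∑ q : Σ j, Fin (nz j),
    S.Phi ⟨i, k⟩ q * (S.AST q.1 *ᵥ p.1 q.1 + S.BS q.1 *ᵥ p.2 q.1) q.2) + S.BT i *ᵥ p.2 i
  map_add' p p' := by
    ext i : 1
    simp only [Prod.fst_add, Prod.snd_add, Pi.add_apply, Matrix.mulVec_add]
    rw [show (fun k => ∑ q : Σ j, Fin (nz j), S.Phi ⟨i, k⟩ q *
        ((S.AST q.1 *ᵥ p.1 q.1) q.2 + (S.AST q.1 *ᵥ p'.1 q.1) q.2 +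
          ((S.BS q.1 *ᵥ p.2 q.1) q.2 + (S.BS q.1 *ᵥ p'.2 q.1) q.2))) =
        (fun k => ∑ q : Σ j, Fin (nz j), S.Phi ⟨i, k⟩ q *
          ((S.AST q.1 *ᵥ p.1 q.1) q.2 + (S.BS q.1 *ᵥ p.2 q.1) q.2)) +
        (fun k => ∑ q : Σ j, Fin (nz j), S.Phi ⟨i, k⟩ q *
          ((S.AST q.1 *ᵥ p'.1 q.1) q.2 + (S.BS q.1 *ᵥ p'.2 q.1) q.2)) by
      ext k
      rw [Pi.add_apply, ← Finset.sum_add_distrib]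
      exact Finset.sum_congr rfl fun q _ => by ring, Matrix.mulVec_add]
    abel
  map_smul' c p := by
    ext i : 1
    simp only [Prod.smul_fst, Prod.smul_snd, Pi.smul_apply, Matrix.mulVec_smul, Pi.add_apply,
      RingHom.id_apply, smul_add]
    rw [show (fun k => ∑ q : Σ j, Fin (nz j), S.Phi ⟨i, k⟩ q *
        (c • (S.AST q.1 *ᵥ p.1 q.1) q.2 + c • (S.BS q.1 *ᵥ p.2 q.1) q.2)) =
        c • (fun k => ∑ q : Σ j, Fin (nz j), S.Phi ⟨i, k⟩ q *
          ((S.AST q.1 *ᵥ p.1 q.1) q.2 + (S.BS q.1 *ᵥ p.2 q.1) q.2)) by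
      ext k
      rw [Pi.smul_apply, Finset.smul_sum]
      exact Finset.sum_congr rfl fun q _ => by simp only [smul_eq_mul]; ring, Matrix.mulVec_smul]

/-- Controllability in the form used for constructions: no proper subspace of states is closed under
`step` for all external inputs. -/
def StepReachable (S : NetworkedSystem nx nu nv ny nz) : Prop :=
  ∀ W : Submodule ℝ (∀ i, Fin (nx i) → ℝ), (∀ x ∈ W, ∀ u, S.step (x, u) ∈ W) → W = ⊤

/-- The state sequence with initial state `a` and external input `u`. -/
noncomputable def run (S : NetworkedSystem nx nu nv ny nz) (u : ℕ → ∀ i, Fin (nu i) → ℝ)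
    (a : ∀ i, Fin (nx i) → ℝ) : ℕ → ∀ i, Fin (nx i) → ℝ
  | 0 => a
  | t + 1 => S.step (run S u a t, u t)

theorem isTrajectory_run (S : NetworkedSystem nx nu nv ny nz) (hASS : S.ASS = 0)
    (u : ℕ → ∀ i, Fin (nu i) → ℝ) (a : ∀ i, Fin (nx i) → ℝ) :
    ∃ v z y, S.IsTrajectory (S.run u a) u v z y := by
  let z : ℕ → ∀ i, Fin (nz i) → ℝ := fun t i => S.AST i *ᵥ S.run u a t i + S.BS i *ᵥ u t i
  let v : ℕ → ∀ i, Fin (nv i) → ℝ := fun t i k =>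
    ∑ q : Σ j, Fin (nz j), S.Phi ⟨i, k⟩ q * z t q.1 q.2
  exact ⟨v, z, fun t i => S.CT i *ᵥ S.run u a t i + S.CS i *ᵥ v t i + S.D i *ᵥ u t i,
    fun t i => rfl, fun t i => by simp [z, hASS], fun t i => rfl, fun t i k => rfl⟩

theorem run_congr (S : NetworkedSystem nx nu nv ny nz) {u u' : ℕ → ∀ i, Fin (nu i) → ℝ}
    (a : ∀ i, Fin (nx i) → ℝ) (T : ℕ) (h : ∀ t < T, u t = u' t) : S.run u a T = S.run u' a T := by
  induction T with
  | zero => rfl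
  | succ T ih => rw [run, run, ih fun t ht => h t (by omega), h T (by omega)]

theorem StepReachable.controllable {S : NetworkedSystem nx nu nv ny nz} (h : S.StepReachable)
    (hASS : S.ASS = 0) : S.Controllable := by
  -- `R T` is the space of states that can be reached from the origin in time `T`
  let R : ℕ → Submodule ℝ (∀ i, Fin (nx i) → ℝ) :=
    fun T => (fun P => (P.prod ⊤).map S.step)^[T] ⊥
  have hR : ∀ T, R (T + 1) = ((R T).prod ⊤).map S.step := fun T =>
    Function.iterate_succ_apply' _ T ⊥
  have hmono : Monotone R := monotone_nat_of_le_succ fun T => by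
    induction T with
    | zero => exact bot_le
    | succ T ih =>
      rw [hR, hR (T + 1)]
      exact Submodule.map_mono (Submodule.prod_mono ih le_rfl)
  obtain ⟨T, hT⟩ := WellFoundedGT.monotone_chain_condition ⟨R, hmono⟩
  have htop : R T = ⊤ := h _ fun x hx u => by
    have e : R T = R (T + 1) := hT (T + 1) T.le_succ
    rw [e, hR]
    exact ⟨(x, u), ⟨hx, trivial⟩, rfl⟩
  intro a b
  have key : ∀ T, ∀ c ∈ R T, ∃ u, S.run u a T = S.run 0 a T + c := fun T => by
    induction T with
    | zero =>
      intro c hc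
      have : c = 0 := by simpa [R] using hc
      exact ⟨0, by rw [this, add_zero]⟩
    | succ T ih =>
      intro c hc
      rw [hR] at hc
      obtain ⟨⟨c', w⟩, ⟨hc', -⟩, rfl⟩ := hc
      obtain ⟨u, hu⟩ := ih c' hc'
      refine ⟨Function.update u T w, ?_⟩
      rw [run, run, Function.update_self, S.run_congr a T (u' := u) fun t ht =>
        Function.update_of_ne ht.ne _ _, hu, ← map_add, Prod.mk_add_mk, Pi.zero_apply, zero_add]
  obtain ⟨u, hu⟩ := key T (b - S.run 0 a T) (htop ▸ trivial)
  obtain ⟨v, z, y, hx⟩ := S.isTrajectory_run hASS u a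
  exact ⟨T, _, u, v, z, y, hx, rfl, by rw [hu, add_sub_cancel]⟩

/-- The network with all matrices transposed, in which inputs and outputs change roles. -/
def dual (S : NetworkedSystem nx nu nv ny nz) : NetworkedSystem nx ny nz nu nv where
  ATT i := (S.ATT i)ᵀ
  ATS i := (S.AST i)ᵀ
  BT i := (S.CT i)ᵀ
  AST i := (S.ATS i)ᵀ
  ASS i := (S.ASS i)ᵀ
  BS i := (S.CS i)ᵀ
  CT i := (S.BT i)ᵀ
  CS i := (S.BS i)ᵀ
  D i := (S.D i)ᵀ
  Phi := S.Phiᵀ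

theorem IsTrajectory.sub {S : NetworkedSystem nx nu nv ny nz} {x u v z y x' u' v' z' y'}
    (h : S.IsTrajectory x u v z y) (h' : S.IsTrajectory x' u' v' z' y') :
    S.IsTrajectory (x - x') (u - u') (v - v') (z - z') (y - y') := by
  refine ⟨fun t i => ?_, fun t i => ?_, fun t i => ?_, fun t i k => ?_⟩
  · simp only [Pi.sub_apply, h.state, h'.state, Matrix.mulVec_sub]; abel
  · simp only [Pi.sub_apply, h.internal, h'.internal, Matrix.mulVec_sub]; abel
  · simp only [Pi.sub_apply, h.external, h'.external, Matrix.mulVec_sub]; abel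
  · simp only [Pi.sub_apply, h.connection, h'.connection, mul_sub, Finset.sum_sub_distrib]

/-- On motions of the dual network with zero external signals, a step of the dual is the adjoint of
a step of the network, whatever the input `u` of the latter. -/
theorem dual_pairing {S : NetworkedSystem nx nu nv ny nz} (hASS : S.ASS = 0) {d v z}
    (h : S.dual.IsTrajectory d 0 v z 0) (x : ∀ i, Fin (nx i) → ℝ) (u : ∀ i, Fin (nu i) → ℝ)
    (t : ℕ) :
    ∑ i, S.step (x, u) i ⬝ᵥ d t i = ∑ i, x i ⬝ᵥ d (t + 1) i := by
  have hd : ∀ i, d (t + 1) i = (S.ATT i)ᵀ *ᵥ d t i + (S.AST i)ᵀ *ᵥ v t i := fun i => by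
    simpa [dual] using h.state t i
  have hz : ∀ i, z t i = (S.ATS i)ᵀ *ᵥ d t i := fun i => by
    simpa [dual, hASS] using h.internal t i
  have hy : ∀ i, (S.BT i)ᵀ *ᵥ d t i + (S.BS i)ᵀ *ᵥ v t i = 0 := fun i => by
    simpa [dual] using (h.external t i).symm
  have hv : ∀ i k, v t i k = ∑ q : Σ j, Fin (nv j), S.Phi q ⟨i, k⟩ * z t q.1 q.2 := h.connection t
  let z' : ∀ i, Fin (nz i) → ℝ := fun i => S.AST i *ᵥ x i + S.BS i *ᵥ u i
  let v' : ∀ i, Fin (nv i) → ℝ := fun i k => ∑ q : Σ j, Fin (nz j), S.Phi ⟨i, k⟩ q * z' q.1 q.2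
  have hs : ∀ i, S.step (x, u) i = S.ATT i *ᵥ x i + S.ATS i *ᵥ v' i + S.BT i *ᵥ u i := fun i => rfl
  -- the connection matrices of the two networks are adjoint
  have hadj : ∑ i, v' i ⬝ᵥ z t i = ∑ i, z' i ⬝ᵥ v t i := by
    have e1 : ∑ i, v' i ⬝ᵥ z t i = ∑ p : Σ j, Fin (nv j), v' p.1 p.2 * z t p.1 p.2 := by
      rw [Fintype.sum_sigma]; rfl
    have e2 : ∑ i, z' i ⬝ᵥ v t i = ∑ q : Σ j, Fin (nz j), z' q.1 q.2 * v t q.1 q.2 := by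
      rw [Fintype.sum_sigma]; rfl
    rw [e1, e2]
    simp only [v', hv, Finset.sum_mul, Finset.mul_sum]
    rw [Finset.sum_comm]
    exact Finset.sum_congr rfl fun q _ => Finset.sum_congr rfl fun p _ => by ring
  have tr : ∀ {a b : ℕ} (M : Matrix (Fin a) (Fin b) ℝ) (p : Fin b → ℝ) (q : Fin a → ℝ),
      M *ᵥ p ⬝ᵥ q = p ⬝ᵥ Mᵀ *ᵥ q := fun M p q => by
    rw [Matrix.mulVec_transpose, dotProduct_comm, Matrix.dotProduct_mulVec, dotProduct_comm]
  have hu : ∀ i, u i ⬝ᵥ (S.BT i)ᵀ *ᵥ d t i = - (S.BS i *ᵥ u i ⬝ᵥ v t i) := fun i => by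
    rw [tr, eq_neg_iff_add_eq_zero, ← dotProduct_add, hy, dotProduct_zero]
  calc ∑ i, S.step (x, u) i ⬝ᵥ d t i
      = ∑ i, (x i ⬝ᵥ (S.ATT i)ᵀ *ᵥ d t i - S.BS i *ᵥ u i ⬝ᵥ v t i) + ∑ i, v' i ⬝ᵥ z t i := by
        rw [← Finset.sum_add_distrib]
        refine Finset.sum_congr rfl fun i _ => ?_
        rw [hs, add_dotProduct, add_dotProduct, tr, tr, tr, ← hz, hu]
        ring
    _ = ∑ i, x i ⬝ᵥ d (t + 1) i := by
        rw [hadj, ← Finset.sum_add_distrib]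
        refine Finset.sum_congr rfl fun i _ => ?_
        rw [hd, dotProduct_add, ← tr (S.AST i), add_dotProduct]
        ring

theorem StepReachable.dual_observable {S : NetworkedSystem nx nu nv ny nz} (h : S.StepReachable)
    (hASS : S.ASS = 0) : S.dual.Observable := by
  intro x u v z y x' v' z' hx hx'
  have hd := hx.sub hx'
  rw [sub_self, sub_self] at hd
  -- the states orthogonal to the whole difference of the two motions
  let W : Submodule ℝ (∀ i, Fin (nx i) → ℝ) :=
    { carrier := {w | ∀ t, ∑ i, w i ⬝ᵥ (x - x') t i = 0}
      add_mem' := fun {a b} ha hb t => by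
        simp only [Pi.add_apply, add_dotProduct, Finset.sum_add_distrib, ha t, hb t, add_zero]
      zero_mem' := fun t => by simp
      smul_mem' := fun c a ha t => by
        simp only [Pi.smul_apply, smul_dotProduct, ← Finset.smul_sum, ha t, smul_zero] }
  have htop := h W fun w hw u t => (dual_pairing hASS hd w u t).trans (hw (t + 1))
  have h0 : ∑ i, (x - x') 0 i ⬝ᵥ (x - x') 0 i = 0 :=
    (htop ▸ Submodule.mem_top : (x - x') 0 ∈ W) 0
  rw [Finset.sum_eq_zero_iff_of_nonneg fun i _ => by
    simpa using dotProduct_star_self_nonneg ((x - x') 0 i)] at h0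
  ext i : 1
  exact sub_eq_zero.1 (dotProduct_self_eq_zero.1 (h0 i (Finset.mem_univ i)))

/-! ### Construction of a controllable network -/

/-- A network in which the internal input `p` receives the signal `h p ⬝ x + s p ⬝ u` of the
subsystem `src p`, through an internal output made for `p` alone. Only the components of `h p` and
`s p` at `src p` matter; they are indexed by all subsystems to avoid dependence of types on `src`.
There are no external outputs. -/
theorem exists_dedicated_network {N : ℕ} {nx nu nv : Fin N → ℕ}
    (A : ∀ i, Matrix (Fin (nx i)) (Fin (nx i)) ℝ) (G : ∀ i, Matrix (Fin (nx i)) (Fin (nv i)) ℝ)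
    (B : ∀ i, Matrix (Fin (nx i)) (Fin (nu i)) ℝ) (src : (Σ i, Fin (nv i)) → Fin N)
    (h : (Σ i, Fin (nv i)) → ∀ j, Fin (nx j) → ℝ) (s : (Σ i, Fin (nv i)) → ∀ j, Fin (nu j) → ℝ) :
    ∃ (nz : Fin N → ℕ) (S : NetworkedSystem nx nu nv 0 nz), S.ATT = A ∧ S.ASS = 0 ∧
      S.IsSelection ∧ S.dual.IsSelection ∧
      ∀ x u i, S.step (x, u) i = A i *ᵥ x i + G i *ᵥ (fun k =>
        h ⟨i, k⟩ (src ⟨i, k⟩) ⬝ᵥ x (src ⟨i, k⟩) + s ⟨i, k⟩ (src ⟨i, k⟩) ⬝ᵥ u (src ⟨i, k⟩)) +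
          B i *ᵥ u i := by
  classical
  let nz : Fin N → ℕ := fun j => Fintype.card {p // src p = j}
  let e : (Σ j, Fin (nz j)) ≃ Σ i, Fin (nv i) :=
    (Equiv.sigmaCongrRight fun j => (Fintype.equivFin {p // src p = j}).symm).trans
      (Equiv.sigmaFiberEquiv src)
  have he : ∀ q, src (e q) = q.1 := fun q =>
    ((Fintype.equivFin {p // src p = q.1}).symm q.2).2
  let S : NetworkedSystem nx nu nv 0 nz :=
    { ATT := A, ATS := G, BT := B
      AST := fun j => Matrix.of fun q => h (e ⟨j, q⟩) j
      ASS := 0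
      BS := fun j => Matrix.of fun q => s (e ⟨j, q⟩) j
      CT := 0, CS := 0, D := 0
      Phi := Matrix.of fun p q => if e q = p then 1 else 0 }
  refine ⟨nz, S, rfl, rfl, fun p => ⟨e.symm p, by simp [S], fun q hq => ?_⟩,
    fun q => ⟨e q, by simp [S, dual], fun p hp => ?_⟩, fun x u i => ?_⟩
  · have : e q ≠ p := fun h => hq (by simp [← h])
    simp [S, this]
  · simp [S, dual, hp.symm]
  · have : ∀ p, ∑ q, S.Phi p q * (S.AST q.1 *ᵥ x q.1 + S.BS q.1 *ᵥ u q.1) q.2 =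
        h p (src p) ⬝ᵥ x (src p) + s p (src p) ⬝ᵥ u (src p) := fun p => by
      rw [Finset.sum_eq_single (e.symm p)]
      · obtain ⟨q, rfl⟩ := e.surjective p
        rw [Equiv.symm_apply_apply, he]
        simp [S, Matrix.mulVec]
      · intro q _ hq
        have : e q ≠ p := fun h => hq (by simp [← h])
        simp [S, this]
      · simp
    change A i *ᵥ x i + G i *ᵥ (fun k => _) + B i *ᵥ u i = _
    congr 3
    exact funext fun k => this ⟨i, k⟩

/-- The chain of subsystems: drive columns are fed by the preceding subsystem, the other internal
inputs by the own state. -/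
theorem exists_stepReachable {N : ℕ} {nx : Fin N → ℕ} (A : ∀ i, Matrix (Fin (nx i)) (Fin (nx i)) ℝ)
    (nu nv : Fin N → ℕ) (hroot : ∃ i, 0 < nu i) (hA : ∀ i, maxGeomMult (A i) ≤ nu i + nv i) :
    ∃ (nz : Fin N → ℕ) (S : NetworkedSystem nx nu nv 0 nz), S.ATT = A ∧ S.ASS = 0 ∧
      S.IsSelection ∧ S.dual.IsSelection ∧ S.StepReachable := by
  classical
  choose B G F f hF hprobe using fun i => exists_local_design (A i) (hA i)
  obtain ⟨r, hr⟩ := hroot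
  let T : Finset (Fin N) := Finset.univ.filter fun i => nu i = 0 ∧ 0 < nx i
  have hT : ∀ i, i ∈ T ↔ nu i = 0 ∧ 0 < nx i := fun i => by simp [T]
  have hrT : r ∉ T := by rw [hT]; omega
  obtain ⟨pred, hinj, hpred, hind⟩ := exists_chain r T hrT
  let src : (Σ i, Fin (nv i)) → Fin N := fun p => if IsDrive (nu p.1) p.2 then pred p.1 else p.1
  have hsrcd : ∀ i k, IsDrive (nu i) k → src ⟨i, k⟩ = pred i := fun i k hk => if_pos hk
  have hsrcs : ∀ i k, ¬ IsDrive (nu i) k → src ⟨i, k⟩ = i := fun i k hk => if_neg hk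
  clear_value src
  let h : (Σ i, Fin (nv i)) → ∀ j, Fin (nx j) → ℝ := fun p =>
    if IsDrive (nu p.1) p.2 then (if p.1 ∈ T then f else 0) else Pi.single p.1 (F p.1 p.2)
  -- a start of the chain that has no state passes on its external input instead
  let s : (Σ i, Fin (nv i)) → ∀ j, Fin (nu j) → ℝ := fun p j _ =>
    if IsDrive (nu p.1) p.2 ∧ p.1 ∈ T ∧ nx j = 0 then 1 else 0
  obtain ⟨nz, S, hATT, hASS, hsel, hdsel, hstep⟩ := exists_dedicated_network A G B src h s
  refine ⟨nz, S, hATT, hASS, hsel, hdsel, fun W hW => ?_⟩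
  -- `d i` is the drive column of `i ∈ T`, and `g j` the direction driven by subsystem `j`
  let d : ∀ i, Fin (nx i) → ℝ := fun i => G i *ᵥ fun k => if IsDrive (nu i) k then 1 else 0
  have hd : ∀ i k, IsDrive (nu i) k → (G i).col k = d i := fun i k hk => by
    have : (fun l : Fin (nv i) => if IsDrive (nu i) l then (1 : ℝ) else 0) = Pi.single k 1 := by
      ext l
      by_cases hl : l = k
      · subst hl; simp [hk]
      · have : ¬ IsDrive (nu i) l := fun h => hl (Fin.ext (h.2.trans hk.2.symm))
        simp [hl, this]
    simp only [d, this, Matrix.mulVec_single_one]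
  let g : Fin N → ∀ i, Fin (nx i) → ℝ := fun j i => if i ∈ T ∧ pred i = j then d i else 0
  have hg : ∀ i ∈ T, g (pred i) = Pi.single i (d i) := fun i hi => by
    ext j : 1
    by_cases hj : j = i
    · subst hj; simp [g, hi]
    · have : ¬ (j ∈ T ∧ pred j = pred i) := fun h => hj (hinj h.1 hi h.2)
      simp [g, this, hj]
  have hG0 : ∀ i, (G i *ᵥ fun _ => (0 : ℝ)) = 0 := fun i => Matrix.mulVec_zero _
  -- a state of subsystem `j` evolves by the locally closed loop and drives the successor of `j`
  have hstate : ∀ j ξ, S.step (Pi.single j ξ, 0) =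
      Pi.single j (A j *ᵥ ξ + G j *ᵥ fun k => F j k ⬝ᵥ ξ) + (f j ⬝ᵥ ξ) • g j := fun j ξ => by
    ext i : 1
    have hv : (fun k => h ⟨i, k⟩ (src ⟨i, k⟩) ⬝ᵥ
          (Pi.single j ξ : ∀ i, Fin (nx i) → ℝ) (src ⟨i, k⟩) +
          s ⟨i, k⟩ (src ⟨i, k⟩) ⬝ᵥ (0 : ∀ i, Fin (nu i) → ℝ) (src ⟨i, k⟩)) =
        (fun k => F i k ⬝ᵥ (Pi.single j ξ : ∀ i, Fin (nx i) → ℝ) i) +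
        (if i ∈ T ∧ pred i = j then f j ⬝ᵥ ξ else 0) •
          (fun k => if IsDrive (nu i) k then (1 : ℝ) else 0) := by
      ext k
      by_cases hk : IsDrive (nu i) k
      · rw [hsrcd i k hk]
        by_cases hi : i ∈ T
        · by_cases hp : pred i = j
          · subst hp
            simp [h, hk, hi, hF i k hk]
          · simp [h, hk, hi, hF i k hk, hp]
        · simp [h, hk, hi, hF i k hk]
      · rw [hsrcs i k hk]
        simp only [Pi.add_apply, Pi.smul_apply, hk, if_false, smul_zero, add_zero, h,
          Pi.single_eq_same, Pi.zero_apply, dotProduct_zero]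
    rw [hstep, hv, Matrix.mulVec_add, Matrix.mulVec_smul]
    change _ + (_ + _ • d i) + _ = _
    by_cases hi : i ∈ T ∧ pred i = j <;> by_cases hij : i = j
    · subst hij; simp [g, hi, add_assoc]
    · simp [g, hi, hij, hG0]
    · subst hij; simp [g, hi]
    · simp [g, hi, hij, hG0]
  have hlocal : ∀ j, (∀ k, (Pi.single j ((B j).col k) : ∀ i, Fin (nx i) → ℝ) ∈ W) →
      (∀ k, IsDrive (nu j) k → (Pi.single j ((G j).col k) : ∀ i, Fin (nx i) → ℝ) ∈ W) →
      (∀ ξ, (Pi.single j ξ : ∀ i, Fin (nx i) → ℝ) ∈ W) ∧ (0 < nx j → g j ∈ W) := fun j hB hG =>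
    hprobe j W (LinearMap.single ℝ (fun i => Fin (nx i) → ℝ) j) (g j)
      (fun ξ hξ => by simpa only [LinearMap.coe_single, hstate] using hW _ hξ 0) hB hG
  have hB : ∀ j, 0 < nx j → ∀ k, (Pi.single j ((B j).col k) : ∀ i, Fin (nx i) → ℝ) ∈ W :=
    fun j hj k => by
      have h1 := hW 0 W.zero_mem (Pi.single j (Pi.single k 1))
      convert h1 using 1
      ext i : 1
      rw [hstep]
      have hs0 : ∀ p, s p (src p) ⬝ᵥ
          (Pi.single j (Pi.single k 1) : ∀ i, Fin (nu i) → ℝ) (src p) = 0 := fun p => by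
        by_cases hp : src p = j
        · have : nx (src p) ≠ 0 := by rw [hp]; omega
          simp [s, this, dotProduct]
        · simp [hp]
      simp only [hs0, Pi.zero_apply, dotProduct_zero, add_zero, Matrix.mulVec_zero, zero_add]
      rw [hG0, zero_add]
      by_cases hij : i = j
      · subst hij; simp
      · simp [hij]
  have hactive : ∀ j, 0 < nu j → 0 < nx j →
      (∀ ξ, (Pi.single j ξ : ∀ i, Fin (nx i) → ℝ) ∈ W) ∧ g j ∈ W := fun j hu hx => by
    obtain ⟨h1, h2⟩ := hlocal j (hB j hx) fun k hk => absurd hk.1 hu.ne'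
    exact ⟨h1, h2 hx⟩
  have hrootg : g r ∈ W := by
    rcases Nat.eq_zero_or_pos (nx r) with hx | hx
    · have h1 := hW 0 W.zero_mem (Pi.single r (Pi.single ⟨0, hr⟩ 1))
      convert h1 using 1
      ext i : 1
      rw [hstep]
      have hBi : B i *ᵥ (Pi.single r (Pi.single ⟨0, hr⟩ 1) : ∀ i, Fin (nu i) → ℝ) i = 0 := by
        by_cases hi : i = r
        · subst hi
          ext l
          exact absurd l.2 (by omega)
        · simp [hi]
      rw [hBi]
      simp only [Pi.zero_apply, dotProduct_zero, Matrix.mulVec_zero, zero_add, add_zero]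
      have hv : (fun k => s ⟨i, k⟩ (src ⟨i, k⟩) ⬝ᵥ
          (Pi.single r (Pi.single ⟨0, hr⟩ 1) : ∀ i, Fin (nu i) → ℝ) (src ⟨i, k⟩)) =
          (if i ∈ T ∧ pred i = r then (1 : ℝ) else 0) •
            (fun k => if IsDrive (nu i) k then (1 : ℝ) else 0) := by
        ext k
        by_cases hk : IsDrive (nu i) k
        · rw [hsrcd i k hk]
          by_cases hi : i ∈ T
          · by_cases hp : pred i = r
            · rw [hp]
              simp [s, hk, hi, hx]
            · simp [hp]
          · simp [s, hk, hi, dotProduct]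
        · simp [s, hk, dotProduct]
      rw [hv, Matrix.mulVec_smul]
      change _ = _ • d i
      by_cases hi : i ∈ T ∧ pred i = r <;> simp [g, hi]
    · exact (hactive r hr hx).2
  have hchain : ∀ i ∈ T, g i ∈ W ∧ ∀ ξ, (Pi.single i ξ : ∀ i, Fin (nx i) → ℝ) ∈ W := fun i hi => by
    have hTg : ∀ i ∈ T, g (pred i) ∈ W → g i ∈ W ∧
        ∀ ξ, (Pi.single i ξ : ∀ i, Fin (nx i) → ℝ) ∈ W := fun i hi hp => by
      rw [hg i hi] at hp
      obtain ⟨h1, h2⟩ := hlocal i (hB i ((hT i).1 hi).2) fun k hk => by rwa [hd i k hk]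
      exact ⟨h2 ((hT i).1 hi).2, h1⟩
    refine hTg i hi ?_
    rcases Finset.mem_insert.1 (hpred i hi) with hp | hp
    · rw [hp]; exact hrootg
    · exact hind (fun i => g i ∈ W) hrootg (fun i hi hp => (hTg i hi hp).1) _ hp
  have hall : ∀ j ξ, (Pi.single j ξ : ∀ i, Fin (nx i) → ℝ) ∈ W := fun j ξ => by
    rcases Nat.eq_zero_or_pos (nx j) with hx | hx
    · have : ξ = 0 := funext fun l => absurd l.2 (by omega)
      rw [this, Pi.single_zero]
      exact W.zero_mem
    · rcases Nat.eq_zero_or_pos (nu j) with hu | hu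
      · exact (hchain j ((hT j).2 ⟨hu, hx⟩)).2 ξ
      · exact (hactive j hu hx).1 ξ
  refine Submodule.eq_top_iff'.2 fun x => ?_
  rw [← Finset.univ_sum_single x]
  exact W.sum_mem fun j _ => hall j (x j)

theorem wellPosed_of_ASS_eq_zero {S : NetworkedSystem nx nu nv ny nz} (h : S.ASS = 0) :
    S.WellPosed := by
  simp [WellPosed, h]

end NetworkedSystem

theorem theorem3 {N : ℕ} (nx : Fin N → ℕ) (A : ∀ i, Matrix (Fin (nx i)) (Fin (nx i)) ℝ) :
    (∀ ny nz : Fin N → ℕ, (∃ i, 0 < ny i) →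
      ((∃ (nu nv : Fin N → ℕ) (S : NetworkedSystem nx nu nv ny nz),
          S.ATT = A ∧ S.WellPosed ∧ S.IsSelection ∧ S.Observable) ↔
        ∀ i, maxGeomMult (A i) ≤ ny i + nz i)) ∧
    (∀ nu nv : Fin N → ℕ, (∃ i, 0 < nu i) →
      ((∃ (ny nz : Fin N → ℕ) (S : NetworkedSystem nx nu nv ny nz),
          S.ATT = A ∧ S.WellPosed ∧ S.IsSelection ∧ S.Controllable) ↔
        ∀ i, maxGeomMult (A i) ≤ nu i + nv i)) := by
  refine ⟨fun ny nz hy => ⟨?_, fun h => ?_⟩, fun nu nv hu => ⟨?_, fun h => ?_⟩⟩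
  · rintro ⟨nu, nv, S, rfl, -, -, hS⟩ i
    exact hS.maxGeomMult_le i
  · obtain ⟨nv, S, hATT, hASS, -, hsel, hS⟩ :=
      NetworkedSystem.exists_stepReachable (fun i => (A i)ᵀ) ny nz hy
        fun i => (maxGeomMult_transpose (A i)).trans_le (h i)
    refine ⟨0, nv, S.dual, ?_, NetworkedSystem.wellPosed_of_ASS_eq_zero ?_, hsel,
      hS.dual_observable hASS⟩
    · ext i : 1
      simp [NetworkedSystem.dual, hATT]
    · ext i : 1
      simp [NetworkedSystem.dual, hASS]
  · rintro ⟨ny, nz, S, rfl, -, -, hS⟩ i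
    exact hS.maxGeomMult_le i
  · obtain ⟨nz, S, hATT, hASS, hsel, -, hS⟩ := NetworkedSystem.exists_stepReachable A nu nv hu h
    exact ⟨0, nz, S, hATT, NetworkedSystem.wellPosed_of_ASS_eq_zero hASS, hsel,
      hS.controllable hASS⟩
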